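/- \textbf{Theorem (uniform estimate for large $n$ and moderate $d$).} For integers $n\ge 1$, $d\ge 2$, let $p_1,\dots,p_n$ be independent and uniformly distributed on $[0,1]^d$. A point $p$ is said to $k$-dominate a point $q$ if there is a set of $k$ coordinates in all of which $p$ is at most $q$, and $p$ is strictly less than $q$ in at least one of these $k$ coordinates. Let $M_{d,k}(n)$ be the number of points among $p_1,\dots,p_n$ that are not $k$-dominated by any other of these points. Let $W$ be the principal branch of the Lambert function, i.e. $W(z)e^{W(z)}=z$ with $W(z)>0$ for $z>0$. If $d\ge 3$ and $$\frac{2\log n}{d^2}-W(2\log n)\to\infty,$$ then $$\mathbb{E}[M_{d,d-1}(n)]=\frac{n^{-\frac1{d-1}}}{d-1}\,\Gamma\!\left(\frac1{d-1}\right)^{d}\left(1+O\!\left(d\,n^{-\frac1{(d-1)(d-2)}}\right)\right)$$ uniformly in $d$ for large $n$. Explicitly: there is an absolute constant $C$ such that for every function $K$ with $K(n)\to\infty$ as $n\to\infty$ there is an $n_0$ such that, for all $n\ge n_0$ and all integers $d\ge 3$ with $\frac{2\log n}{d^2}-W(2\log n)\ge K(n)$, there is a real $\varepsilon$ with $|\varepsilon|\le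 C\,d\,n^{-\frac1{(d-1)(d-2)}}$ and $$\mathbb{E}[M_{d,d-1}(n)]=\frac{n^{-\frac1{d-1}}}{d-1}\,\Gamma\!\left(\frac1{d-1}\right)^{d}(1+\varepsilon).$$ -/

import Mathlib

open MeasureTheory ProbabilityTheory Filter

noncomputable section

/-- `p` `k`-dominates `q`: there are `k` coordinates in which `p` is at most `q`, and `p` is
strictly smaller than `q` in at least one of these `k` coordinates. -/
def KDominates {d : ℕ} (k : ℕ) (p q : Fin d → ℝ) : Prop :=
  ∃ S : Finset (Fin d), S.card = k ∧ (∀ j ∈ S, p j ≤ q j) ∧ ∃ j ∈ S, p j < q j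

/-- The number of `k`-dominant skyline points of the dataset `p 0, …, p (n - 1)`, that is, of the
points that are not `k`-dominated by any other point of the dataset. -/
def kSkylineCount {n d : ℕ} (k : ℕ) (p : Fin n → Fin d → ℝ) : ℕ :=
  Set.ncard {i : Fin n | ∀ j : Fin n, j ≠ i → ¬ KDominates k (p j) (p i)}

/-- The principal branch of the Lambert `W` function: for `x ≥ -1/e`, the unique `w ≥ -1` with
`w * exp w = x`. -/
def lambertW (x : ℝ) : ℝ :=
  Function.invFunOn (fun w : ℝ => w * Real.exp w) (Set.Ici (-1)) x

theorem lambertW_mul_exp {x : ℝ} (hx : 0 ≤ x) : lambertW x * Real.exp (lambertW x) = x := by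
  have hmem : x ∈ Set.Icc ((fun w : ℝ => w * Real.exp w) 0) ((fun w : ℝ => w * Real.exp w) x) := by
    refine ⟨by simpa using hx, ?_⟩
    have h1 : (1 : ℝ) ≤ Real.exp x := Real.one_le_exp hx
    have : x * 1 ≤ x * Real.exp x := mul_le_mul_of_nonneg_left h1 hx
    simpa using this
  have hcont : ContinuousOn (fun w : ℝ => w * Real.exp w) (Set.Icc 0 x) := by fun_prop
  obtain ⟨a, ha, hax⟩ := intermediate_value_Icc hx hcont hmem
  have ha' : a ∈ Set.Ici (-1 : ℝ) := by
    have := ha.1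
    simp only [Set.mem_Ici]
    linarith
  exact Function.invFunOn_eq (f := fun w : ℝ => w * Real.exp w) ⟨a, ha', hax⟩

theorem lambertW_pos {x : ℝ} (hx : 0 < x) : 0 < lambertW x := by
  have h := lambertW_mul_exp hx.le
  by_contra hneg
  have : lambertW x * Real.exp (lambertW x) ≤ 0 :=
    mul_nonpos_of_nonpos_of_nonneg (not_lt.mp hneg) (Real.exp_pos _).le
  linarith

end

/-! By independence the expectation is `n` times the integral over the cube of `(1 - V) ^ (n - 1)`,
where `V x` is the probability that one uniform point dominates `x` (`integral_kSkylineCount`). A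
dominating point may exceed `x` in at most one coordinate, so `V` is nearly the sum `S` of the
products of all but one coordinate: it lies between `S - d ∏ x i` and `S`. Hence the integrand is
close to `exp (-n S)`. Extended to the whole positive orthant, that integral is explicit
(`lintegral_exp_neg_leaveOneOutSum`): taking the `d` leave-one-out products as new coordinates turns
it into a product of Gamma integrals.

Two kinds of error remain. Pointwise errors are bounded by small multiples of `exp (-c n S)`, which
the same formula integrates; AM-GM bounds the overlap `∏ x i` by a power of `S`. The part of the
orthant outside the cube is controlled by the Laplace transform in dimension `d - 1`; comparing
powers of `n` there gives the relative error `n ^ (-1 / ((d - 1) (d - 2)))`, with a factor `d` for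
the choice of the large coordinate. The growth hypothesis enters only through `d ^ 2 ≤ 2 log n`,
which absorbs surplus powers of `d` in the upper bound. -/

/-! ### Laplace transform of the leave-one-out sum -/

/-- The sum, over all coordinates `j`, of the product of the coordinates other than `j`. -/
noncomputable def leaveOneOutSum {d : ℕ} (x : Fin d → ℝ) : ℝ :=
  ∑ j, ∏ i ∈ Finset.univ.erase j, x i

/-- The open positive orthant. -/
def posOrthant (d : ℕ) : Set (Fin d → ℝ) := Set.univ.pi fun _ => Set.Ioi 0

theorem mem_posOrthant {d : ℕ} {x : Fin d → ℝ} : x ∈ posOrthant d ↔ ∀ i, 0 < x i := by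
  simp [posOrthant]

theorem measurableSet_posOrthant (d : ℕ) : MeasurableSet (posOrthant d) :=
  MeasurableSet.univ_pi fun _ => measurableSet_Ioi

theorem continuous_leaveOneOutSum (d : ℕ) :
    Continuous (leaveOneOutSum : (Fin d → ℝ) → ℝ) := by
  unfold leaveOneOutSum
  fun_prop

/-- Monomial change of variables on the positive orthant. -/
theorem lintegral_posOrthant_eq_lintegral_exp_mulVec {d : ℕ} (M : Matrix (Fin d) (Fin d) ℝ)
    (hM : M.det ≠ 0) (g : (Fin d → ℝ) → ENNReal) :
    ∫⁻ y in posOrthant d, g y =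
      ∫⁻ t, ENNReal.ofReal (|M.det| * Real.exp (∑ j, (M.mulVec t) j)) *
        g (fun j => Real.exp ((M.mulVec t) j)) := by
  have hu : IsUnit M := (Matrix.isUnit_iff_isUnit_det M).2 hM.isUnit
  have himage : (fun t : Fin d → ℝ => fun j => Real.exp ((M.mulVec t) j)) '' Set.univ
      = posOrthant d := by
    ext y
    simp only [Set.image_univ, Set.mem_range, mem_posOrthant]
    constructor
    · rintro ⟨t, rfl⟩ i
      exact Real.exp_pos _
    · intro hy
      obtain ⟨t, ht⟩ := (Matrix.mulVec_surjective_iff_isUnit.2 hu) (fun j => Real.log (y j))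
      exact ⟨t, funext fun j => by rw [ht, Real.exp_log (hy j)]⟩
  have hderiv : ∀ t ∈ (Set.univ : Set (Fin d → ℝ)),
      HasFDerivWithinAt (fun t : Fin d → ℝ => fun j => Real.exp ((M.mulVec t) j))
        (LinearMap.toContinuousLinearMap (Matrix.toLin'
          (Matrix.diagonal (fun j => Real.exp ((M.mulVec t) j)) * M))) Set.univ t := by
    intro t _
    rw [hasFDerivWithinAt_univ, hasFDerivAt_pi']
    intro j
    have h1 : HasFDerivAt (fun t : Fin d → ℝ => (M.mulVec t) j)
        ((ContinuousLinearMap.proj j).comp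
          (LinearMap.toContinuousLinearMap (Matrix.toLin' M))) t :=
      ((ContinuousLinearMap.proj j).comp
        (LinearMap.toContinuousLinearMap (Matrix.toLin' M))).hasFDerivAt
    have h2 : (ContinuousLinearMap.proj j).comp (LinearMap.toContinuousLinearMap (Matrix.toLin'
        (Matrix.diagonal (fun j => Real.exp ((M.mulVec t) j)) * M))) =
        Real.exp ((M.mulVec t) j) • ((ContinuousLinearMap.proj j).comp
          (LinearMap.toContinuousLinearMap (Matrix.toLin' M))) := by
      ext v
      have h3 := congrFun (Matrix.mulVec_mulVec v (Matrix.diagonal fun j => Real.exp ((M.mulVec t) j)) M) j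
      rw [Matrix.mulVec_diagonal] at h3
      simpa using h3.symm
    rw [h2]
    exact h1.exp
  have hinj : Set.InjOn (fun t : Fin d → ℝ => fun j => Real.exp ((M.mulVec t) j)) Set.univ := by
    intro s _ t _ hst
    refine Matrix.mulVec_injective_of_isUnit hu (funext fun j => ?_)
    exact Real.exp_injective (congrFun hst j)
  rw [← himage, lintegral_image_eq_lintegral_abs_det_fderiv_mul volume MeasurableSet.univ hderiv
    hinj, setLIntegral_univ]
  refine lintegral_congr fun t => ?_
  congr 2
  simp [ContinuousLinearMap.det, Matrix.det_diagonal, abs_mul, Real.exp_sum,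
    Finset.abs_prod, mul_comm]

/-- Up to sign the matrix is a rank-one perturbation of the identity. In logarithmic coordinates it
is the map to leave-one-out products, so this is the constant of the Jacobian. -/
theorem abs_det_ones_sub_one (d : ℕ) (hd : 1 ≤ d) :
    |(Matrix.of fun i j : Fin d => if i = j then (0 : ℝ) else 1).det| = (d : ℝ) - 1 := by
  have h : (Matrix.of fun i j : Fin d => if i = j then (0 : ℝ) else 1) =
      -(1 + Matrix.replicateCol Unit (fun _ : Fin d => (-1 : ℝ)) *
        Matrix.replicateRow Unit (fun _ : Fin d => (1 : ℝ))) := by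
    ext i j
    by_cases hij : i = j
    · simp [hij, Matrix.mul_apply]
    · simp [hij, Matrix.mul_apply]
  have h1 : (1 : ℝ) ≤ d := by exact_mod_cast hd
  rw [h, Matrix.det_neg, Matrix.det_one_add_replicateCol_mul_replicateRow, abs_mul]
  simp [dotProduct]
  rw [abs_of_nonpos (by linarith)]
  ring

/-- The Laplace transform of `leaveOneOutSum` on the positive orthant. -/
theorem lintegral_exp_neg_leaveOneOutSum {d : ℕ} (hd : 2 ≤ d) {r : ℝ} (hr : 0 < r) :
    ∫⁻ x in posOrthant d, ENNReal.ofReal (Real.exp (-(r * leaveOneOutSum x))) =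
      ENNReal.ofReal (1 / ((d : ℝ) - 1) * (1 / r) ^ ((d : ℝ) / ((d : ℝ) - 1)) *
        Real.Gamma (1 / ((d : ℝ) - 1)) ^ d) := by
  have hd' : (2 : ℝ) ≤ d := by exact_mod_cast hd
  have hd1 : 0 < (d : ℝ) - 1 := by linarith
  set a : ℝ := 1 / ((d : ℝ) - 1) with ha
  have ha0 : 0 < a := by positivity
  have had : a * ((d : ℝ) - 1) = 1 := by rw [ha]; field_simp
  set M : Matrix (Fin d) (Fin d) ℝ := Matrix.of fun i j => if i = j then (0 : ℝ) else 1 with hM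
  have hMdet : |M.det| = (d : ℝ) - 1 := abs_det_ones_sub_one d (by omega)
  have hM0 : M.det ≠ 0 := by
    intro h0
    rw [h0, abs_zero] at hMdet
    linarith
  have hMt : ∀ (t : Fin d → ℝ) j, (M.mulVec t) j = ∑ i ∈ Finset.univ.erase j, t i := by
    intro t j
    rw [← Finset.filter_ne Finset.univ j, Finset.sum_filter]
    simp only [Matrix.mulVec, dotProduct]
    refine Finset.sum_congr rfl fun i _ => ?_
    by_cases hij : j = i <;> simp [hM, hij]
  have hMsum : ∀ t : Fin d → ℝ, ∑ j, (M.mulVec t) j = ((d : ℝ) - 1) * ∑ i, t i := by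
    intro t
    have : ∀ j, (M.mulVec t) j = ∑ i, t i - t j := fun j => by
      rw [hMt, ← Finset.add_sum_erase Finset.univ t (Finset.mem_univ j)]; ring
    simp only [this, Finset.sum_sub_distrib]
    simp; ring
  -- The exponent `a - 1` is forced: it makes the density cancel the non-constant part of the
  -- Jacobian of the monomial map.
  set g : (Fin d → ℝ) → ENNReal := fun y =>
    ENNReal.ofReal (∏ j, (y j ^ (a - 1) * Real.exp (-(r * y j)))) with hg
  have hg1 : ∫⁻ y in posOrthant d, g y = ENNReal.ofReal (((1 / r) ^ a * Real.Gamma a) ^ d) := by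
    have hi : IntegrableOn (fun t : ℝ => t ^ (a - 1) * Real.exp (-(r * t))) (Set.Ioi 0) := by
      -- A non-integrable function has integral `0` by convention, but the Gamma formula gives a
      -- positive value.
      by_contra hcon
      have h2 := Real.integral_rpow_mul_exp_neg_mul_Ioi ha0 hr
      rw [integral_undef hcon] at h2
      have : 0 < (1 / r) ^ a * Real.Gamma a :=
        mul_pos (Real.rpow_pos_of_pos (by positivity) _) (Real.Gamma_pos_of_pos ha0)
      linarith
    have hvol : (volume : Measure (Fin d → ℝ)).restrict (posOrthant d) =
        Measure.pi fun _ => (volume : Measure ℝ).restrict (Set.Ioi 0) := by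
      rw [posOrthant, volume_pi, Measure.restrict_pi_pi]
    have hint := Integrable.fintype_prod (f := fun (_ : Fin d) (t : ℝ) =>
      t ^ (a - 1) * Real.exp (-(r * t))) (fun _ => hi)
    have hpos : ∀ᵐ y ∂(volume : Measure (Fin d → ℝ)).restrict (posOrthant d),
        0 ≤ ∏ j, (y j ^ (a - 1) * Real.exp (-(r * y j))) := by
      filter_upwards [ae_restrict_mem (measurableSet_posOrthant d)] with y hy
      rw [mem_posOrthant] at hy
      exact Finset.prod_nonneg fun j _ =>
        mul_nonneg (Real.rpow_nonneg (hy j).le _) (Real.exp_pos _).le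
    rw [hvol] at hpos ⊢
    rw [hg, ← ofReal_integral_eq_lintegral_ofReal hint hpos,
      integral_fintype_prod_eq_prod
        (f := fun (_ : Fin d) (t : ℝ) => t ^ (a - 1) * Real.exp (-(r * t))),
      Finset.prod_const, Real.integral_rpow_mul_exp_neg_mul_Ioi ha0 hr]
    simp
  have hg2 : ∫⁻ y in posOrthant d, g y = ENNReal.ofReal ((d : ℝ) - 1) *
      ∫⁻ x in posOrthant d, ENNReal.ofReal (Real.exp (-(r * leaveOneOutSum x))) := by
    -- Both sides are pulled back to logarithmic coordinates, with the identity matrix on the `x`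
    -- side, and the integrands are then compared pointwise.
    rw [lintegral_posOrthant_eq_lintegral_exp_mulVec M hM0,
      lintegral_posOrthant_eq_lintegral_exp_mulVec (1 : Matrix (Fin d) (Fin d) ℝ) (by simp),
      ← lintegral_const_mul' _ _ ENNReal.ofReal_ne_top]
    refine lintegral_congr fun t => ?_
    simp only [hg]
    rw [← ENNReal.ofReal_mul (by positivity), ← ENNReal.ofReal_mul (by positivity),
      ← ENNReal.ofReal_mul hd1.le, hMdet, hMsum]
    congr 1
    rw [Finset.prod_mul_distrib, ← Real.exp_sum]
    have h1 : ∏ j, Real.exp ((M.mulVec t) j) ^ (a - 1) =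
        Real.exp ((1 - ((d : ℝ) - 1)) * ∑ i, t i) := by
      simp only [← Real.exp_mul]
      rw [← Real.exp_sum, ← Finset.sum_mul, hMsum]
      congr 1
      linear_combination (∑ i, t i) * had
    have h2 : leaveOneOutSum (fun j => Real.exp (t j)) = ∑ j, Real.exp ((M.mulVec t) j) := by
      simp only [leaveOneOutSum, hMt, Real.exp_sum]
    have h3 : Real.exp (∑ i, t i) = Real.exp (((d : ℝ) - 1) * ∑ i, t i) *
        Real.exp ((1 - ((d : ℝ) - 1)) * ∑ i, t i) := by
      rw [← Real.exp_add]; congr 1; ring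
    rw [h1]
    simp only [Matrix.one_mulVec, Matrix.det_one, abs_one, one_mul, h2]
    rw [h3, Finset.sum_neg_distrib, ← Finset.mul_sum]
    ring
  have h := hg1.symm.trans hg2
  have hne : ENNReal.ofReal ((d : ℝ) - 1) ≠ 0 := by simpa using hd1
  have key : ((1 / r) ^ a * Real.Gamma a) ^ d = ((d : ℝ) - 1) *
      (a * (1 / r) ^ ((d : ℝ) / ((d : ℝ) - 1)) * Real.Gamma a ^ d) := by
    rw [mul_pow, ← Real.rpow_natCast ((1 / r) ^ a), ← Real.rpow_mul (by positivity),
      show a * d = (d : ℝ) / ((d : ℝ) - 1) by rw [ha]; ring]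
    linear_combination (-((1 / r) ^ ((d : ℝ) / ((d : ℝ) - 1)) * Real.Gamma a ^ d)) * had
  rw [key, ENNReal.ofReal_mul hd1.le] at h
  exact ((ENNReal.mul_right_inj hne ENNReal.ofReal_ne_top).1 h).symm

/-! ### Tail of the Laplace transform outside the cube -/

/-- Every term except the one omitting `x j` contains the factor `x j`; that single nonnegative term
is dropped. This reduces the tail to one dimension less. -/
theorem mul_leaveOneOutSum_succAbove_le {d : ℕ} {x : Fin (d + 1) → ℝ} (hx : ∀ i, 0 < x i)
    (j : Fin (d + 1)) :
    x j * leaveOneOutSum (fun i => x (j.succAbove i)) ≤ leaveOneOutSum x := by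
  unfold leaveOneOutSum
  rw [Fin.sum_univ_succAbove _ j, Finset.mul_sum]
  have h0 : 0 ≤ ∏ i ∈ Finset.univ.erase j, x i := Finset.prod_nonneg fun i _ => (hx i).le
  refine le_add_of_nonneg_of_le h0 (Finset.sum_le_sum fun k _ => le_of_eq ?_)
  have h1 := Finset.mul_prod_erase Finset.univ x (Finset.mem_univ (j.succAbove k))
  have h2 := Finset.mul_prod_erase Finset.univ (fun i => x (j.succAbove i)) (Finset.mem_univ k)
  rw [Fin.prod_univ_succAbove x j, ← h2] at h1
  refine mul_left_cancel₀ (hx (j.succAbove k)).ne' ?_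
  rw [h1]; ring

/-- The part of the Laplace transform of `leaveOneOutSum` where a given coordinate is large. -/
theorem lintegral_exp_neg_leaveOneOutSum_tail_le {d : ℕ} (hd : 2 ≤ d) {r : ℝ} (hr : 0 < r)
    (j : Fin (d + 1)) :
    ∫⁻ x in posOrthant (d + 1) ∩ {x | 1 < x j},
        ENNReal.ofReal (Real.exp (-(r * leaveOneOutSum x))) ≤
      ENNReal.ofReal ((1 / r) ^ ((d : ℝ) / ((d : ℝ) - 1)) *
        Real.Gamma (1 / ((d : ℝ) - 1)) ^ d) := by
  have hd' : (2 : ℝ) ≤ d := by exact_mod_cast hd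
  have hd1 : 0 < (d : ℝ) - 1 := by linarith
  set f : ℝ × (Fin d → ℝ) → ENNReal := (Set.Ioi 1 ×ˢ posOrthant d).indicator fun p =>
    ENNReal.ofReal (Real.exp (-(r * p.1 * leaveOneOutSum p.2))) with hf
  have hfm : Measurable f := by
    refine Measurable.indicator ?_ (measurableSet_Ioi.prod (measurableSet_posOrthant d))
    have := continuous_leaveOneOutSum d
    exact (ENNReal.continuous_ofReal.comp (by fun_prop)).measurable
  have hset : MeasurableSet (posOrthant (d + 1) ∩ {x | 1 < x j}) :=
    (measurableSet_posOrthant _).inter (measurableSet_lt measurable_const (measurable_pi_apply j))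
  have hmp := volume_preserving_piFinSuccAbove (fun _ : Fin (d + 1) => ℝ) j
  set q : ℝ := (d : ℝ) / ((d : ℝ) - 1) with hq
  have hq1 : q - 1 = 1 / ((d : ℝ) - 1) := by rw [hq]; field_simp; ring
  have hq1' : 1 < q := by
    have : 0 < q - 1 := by rw [hq1]; positivity
    linarith
  calc ∫⁻ x in posOrthant (d + 1) ∩ {x | 1 < x j},
        ENNReal.ofReal (Real.exp (-(r * leaveOneOutSum x)))
      ≤ ∫⁻ x, f (MeasurableEquiv.piFinSuccAbove (fun _ => ℝ) j x) := by
        rw [← lintegral_indicator hset]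
        refine lintegral_mono fun x => ?_
        by_cases hx : x ∈ posOrthant (d + 1) ∩ {x | 1 < x j}
        swap
        · rw [Set.indicator_of_notMem hx]; exact zero_le
        rw [Set.indicator_of_mem hx]
        have hx0 := mem_posOrthant.1 hx.1
        have hmem : MeasurableEquiv.piFinSuccAbove (fun _ => ℝ) j x ∈
            Set.Ioi (1 : ℝ) ×ˢ posOrthant d :=
          ⟨hx.2, mem_posOrthant.2 fun i => hx0 _⟩
        rw [hf, Set.indicator_of_mem hmem]
        refine ENNReal.ofReal_le_ofReal (Real.exp_le_exp.2 (neg_le_neg ?_))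
        have := mul_le_mul_of_nonneg_left (mul_leaveOneOutSum_succAbove_le hx0 j) hr.le
        rw [← mul_assoc] at this
        exact this
    _ = ∫⁻ p, f p := hmp.lintegral_comp hfm
    _ = ∫⁻ t, ∫⁻ y, f (t, y) := by
        rw [Measure.volume_eq_prod, lintegral_prod _ hfm.aemeasurable]
    -- For a fixed large coordinate `t`, the inner integral is the Laplace transform at `r * t`; its
    -- scaling leaves `t ^ (-q)`, integrable on `t > 1` because `q > 1`.
    _ = ∫⁻ t in Set.Ioi (1 : ℝ), ENNReal.ofReal (t ^ (-q) * (1 / ((d : ℝ) - 1) * (1 / r) ^ q *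
          Real.Gamma (1 / ((d : ℝ) - 1)) ^ d)) := by
        rw [← lintegral_indicator measurableSet_Ioi]
        refine lintegral_congr fun t => ?_
        by_cases ht : t ∈ Set.Ioi (1 : ℝ)
        · have ht0 : 0 < t := lt_trans one_pos ht
          rw [Set.indicator_of_mem ht]
          have h1 : ∀ y, f (t, y) = (posOrthant d).indicator (fun y =>
              ENNReal.ofReal (Real.exp (-(r * t * leaveOneOutSum y)))) y := fun y => by
            by_cases hy : y ∈ posOrthant d
            · rw [hf, Set.indicator_of_mem (show (t, y) ∈ Set.Ioi (1 : ℝ) ×ˢ posOrthant d from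
                ⟨ht, hy⟩), Set.indicator_of_mem hy]
            · rw [hf, Set.indicator_of_notMem (fun h => hy h.2), Set.indicator_of_notMem hy]
          rw [lintegral_congr h1, lintegral_indicator (measurableSet_posOrthant d),
            lintegral_exp_neg_leaveOneOutSum hd (mul_pos hr ht0)]
          congr 1
          rw [show 1 / (r * t) = 1 / r * t⁻¹ by field_simp,
            Real.mul_rpow (by positivity) (by positivity), Real.inv_rpow ht0.le,
            Real.rpow_neg ht0.le]
          ring
        · rw [Set.indicator_of_notMem ht]
          have h1 : ∀ y, f (t, y) = 0 := fun y => by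
            rw [hf, Set.indicator_of_notMem (fun h => ht h.1)]
          simp [h1]
    _ = ENNReal.ofReal (∫ t in Set.Ioi (1 : ℝ), t ^ (-q) * (1 / ((d : ℝ) - 1) * (1 / r) ^ q *
          Real.Gamma (1 / ((d : ℝ) - 1)) ^ d)) := by
        rw [ofReal_integral_eq_lintegral_ofReal]
        · exact (integrableOn_Ioi_rpow_of_lt (by linarith) one_pos).mul_const _
        · filter_upwards [ae_restrict_mem measurableSet_Ioi] with t ht
          have ht0 : 0 < t := lt_trans one_pos ht
          have := Real.Gamma_pos_of_pos (show 0 < 1 / ((d : ℝ) - 1) by positivity)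
          positivity
    _ ≤ _ := by
        rw [integral_mul_const, integral_Ioi_rpow_of_lt (by linarith) one_pos]
        refine le_of_eq (congrArg _ ?_)
        rw [Real.one_rpow, show -q + 1 = -(1 / ((d : ℝ) - 1)) by rw [← hq1]; ring]
        field_simp

/-! ### Poisson approximation of powers -/

theorem exp_neg_sub_exp_neg_le (u v : ℝ) : Real.exp (-u) - Real.exp (-v) ≤
    Real.exp (-u) * (v - u) := by
  have h : Real.exp (-v) = Real.exp (-u) * Real.exp (-(v - u)) := by
    rw [← Real.exp_add]; congr 1; ring
  have h1 := Real.add_one_le_exp (-(v - u))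
  have := mul_le_mul_of_nonneg_left h1 (Real.exp_pos (-u)).le
  rw [h]; linarith

theorem mul_exp_neg_le {t : ℝ} : t * Real.exp (-t) ≤ 2 * Real.exp (-(t / 2)) := by
  have h1 := Real.add_one_le_exp (t / 2)
  have h : Real.exp (-(t / 2)) = Real.exp (-t) * Real.exp (t / 2) := by
    rw [← Real.exp_add]; congr 1; ring
  rw [h]
  nlinarith [Real.exp_pos (-t)]

theorem sq_mul_exp_neg_le {t : ℝ} (ht : 0 ≤ t) :
    t ^ 2 * Real.exp (-t) ≤ 8 * Real.exp (-(t / 2)) := by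
  have h1 := Real.quadratic_le_exp_of_nonneg (show 0 ≤ t / 2 by linarith)
  have h : Real.exp (-(t / 2)) = Real.exp (-t) * Real.exp (t / 2) := by
    rw [← Real.exp_add]; congr 1; ring
  rw [h]
  nlinarith [Real.exp_pos (-t)]

theorem rpow_mul_exp_neg_le {t q : ℝ} (ht : 0 ≤ t) (hq0 : 0 ≤ q) (hq : q ≤ 2) :
    t ^ q * Real.exp (-t) ≤ 9 * Real.exp (-(t / 2)) := by
  have h1 : t ^ q ≤ 1 + t ^ 2 := by
    rcases le_total t 1 with h | h
    · have := Real.rpow_le_one ht h hq0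
      nlinarith [sq_nonneg t]
    · have := Real.rpow_le_rpow_of_exponent_le h hq
      rw [Real.rpow_two] at this
      linarith
  have h2 : Real.exp (-t) ≤ Real.exp (-(t / 2)) := Real.exp_le_exp.2 (by linarith)
  have h3 := mul_le_mul_of_nonneg_right h1 (Real.exp_pos (-t)).le
  have h4 := sq_mul_exp_neg_le ht
  linarith

/-- A quantitative lower bound for the Poisson approximation of `(1 - s) ^ m`. -/
theorem exp_neg_mul_le_one_sub_pow_add {s : ℝ} (n m : ℕ) (hn : 1 ≤ n) (hmn : m ≤ n) (hs : 0 ≤ s)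
    {v : ℝ} (hvs : v ≤ s) (hv0 : 0 ≤ v) (hv1 : v ≤ 1) :
    Real.exp (-(n * s)) ≤ (1 - v) ^ m + 8 / n * Real.exp (-(n / 2 * s)) := by
  have hn' : (1 : ℝ) ≤ n := by exact_mod_cast hn
  have h1 : (1 - v) ^ n ≤ (1 - v) ^ m := pow_le_pow_of_le_one (by linarith) (by linarith) hmn
  -- For `s ≤ 1` this is the `n`-th power of `exp (-s) * (1 - s ^ 2) ≤ 1 - s` followed by Bernoulli;
  -- for `s ≥ 1` the left side is nonpositive.
  have h2 : Real.exp (-(n * s)) * (1 - n * s ^ 2) ≤ (1 - v) ^ n := by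
    rcases le_total s 1 with h | h
    · have h3 : (1 - s) ^ n ≤ (1 - v) ^ n := pow_le_pow_left₀ (by linarith) (by linarith) n
      have h4 : Real.exp (-s) * (1 - s ^ 2) ≤ 1 - s := by
        have h5 := Real.add_one_le_exp s
        have h6 : Real.exp (-s) * Real.exp s = 1 := by rw [← Real.exp_add]; simp
        have h7 : Real.exp (-s) * (s + 1) ≤ 1 := by
          have := mul_le_mul_of_nonneg_left h5 (Real.exp_pos (-s)).le
          linarith
        nlinarith
      have hs2 : 0 ≤ 1 - s ^ 2 := by nlinarith
      have h8 := pow_le_pow_left₀ (mul_nonneg (Real.exp_pos (-s)).le hs2) h4 n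
      rw [mul_pow, ← Real.exp_nat_mul] at h8
      have h9 := one_add_mul_le_pow (show (-2 : ℝ) ≤ -s ^ 2 by nlinarith) n
      have h10 := mul_le_mul_of_nonneg_left h9 (Real.exp_pos (-(n * s))).le
      have e1 : (n : ℝ) * -s = -(n * s) := by ring
      have e2 : 1 + (n : ℝ) * -s ^ 2 = 1 - n * s ^ 2 := by ring
      have e3 : 1 + -s ^ 2 = 1 - s ^ 2 := by ring
      rw [e1] at h8
      rw [e2, e3] at h10
      linarith
    · have h3 : 1 - (n : ℝ) * s ^ 2 ≤ 0 := by nlinarith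
      exact (mul_nonpos_of_nonneg_of_nonpos (Real.exp_pos _).le h3).trans
        (pow_nonneg (by linarith) _)
  have h3 := sq_mul_exp_neg_le (t := n * s) (by positivity)
  have h4 : Real.exp (-(n * s)) * (n * s ^ 2) = 1 / n * ((n * s) ^ 2 * Real.exp (-(n * s))) := by
    field_simp
  have h5 := mul_le_mul_of_nonneg_left h3 (show (0 : ℝ) ≤ 1 / n by positivity)
  have h6 : (n : ℝ) / 2 * s = n * s / 2 := by ring
  have h7 : 8 / (n : ℝ) * Real.exp (-(n * s / 2)) = 1 / n * (8 * Real.exp (-(n * s / 2))) := by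
    ring
  rw [h6, h7]
  linarith

/-- A quantitative upper bound for the Poisson approximation of `(1 - v) ^ m`, where `v` is
close to `s`. -/
theorem one_sub_pow_le_exp_neg_add {d n m : ℕ} (hd : 3 ≤ d) (hnm : n = m + 1) {s v p : ℝ}
    (hs : 0 ≤ s) (hv1 : v ≤ 1) (hvs : v ≤ s) (hsv : s ≤ d * v)
    (hp : s - d * p ≤ v) (hps : p ≤ (s / d) ^ ((d : ℝ) / ((d : ℝ) - 1))) :
    (1 - v) ^ m ≤ Real.exp (-(n * s)) +
      11 * Real.exp 1 * d * (n : ℝ) ^ (-(1 / ((d : ℝ) - 1))) *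
        Real.exp (-(n / (2 * d) * s)) := by
  have hd' : (3 : ℝ) ≤ d := by exact_mod_cast hd
  have hn : (n : ℝ) = m + 1 := by rw [hnm]; push_cast; ring
  have hm0 : (0 : ℝ) ≤ m := Nat.cast_nonneg m
  have hn1 : (1 : ℝ) ≤ n := by linarith
  set q : ℝ := (d : ℝ) / ((d : ℝ) - 1) with hq
  have hd1 : 0 < (d : ℝ) - 1 := by linarith
  have hq0 : 0 ≤ q := by positivity
  have hq2 : q ≤ 2 := by rw [hq, div_le_iff₀ hd1]; linarith
  have hqa : 1 - q = -(1 / ((d : ℝ) - 1)) := by rw [hq]; field_simp; ring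
  set t : ℝ := n * s / d with ht
  have ht0 : 0 ≤ t := by positivity
  set N : ℝ := (n : ℝ) ^ (-(1 / ((d : ℝ) - 1))) with hN
  have hN0 : 0 < N := Real.rpow_pos_of_pos (by linarith) _
  have h1 : (1 - v) ^ m ≤ Real.exp (-(m * v)) := by
    have h2 : 1 - v ≤ Real.exp (-v) := by linarith [Real.add_one_le_exp (-v)]
    have h3 := pow_le_pow_left₀ (by linarith) h2 m
    rwa [← Real.exp_nat_mul, show (m : ℝ) * -v = -(m * v) by ring] at h3
  have h2 := exp_neg_sub_exp_neg_le (m * v) (n * s)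
  -- The factor `exp 1` pays for `m = n - 1`: `m * v = n * v - v ≥ t - 1`.
  have h3 : Real.exp (-(m * v)) ≤ Real.exp 1 * Real.exp (-t) := by
    rw [← Real.exp_add]
    refine Real.exp_le_exp.2 ?_
    have : t ≤ n * v := by
      rw [ht, div_le_iff₀ (by linarith)]
      nlinarith
    rw [hn] at this
    linarith
  -- The discrepancy is `n * (s - v) + v`: the overlap bound controls the first part, and `v ≤ s`
  -- the second.
  have h4 : n * s - m * v ≤ d * N * t ^ q + d / n * t := by
    have h5 : (n : ℝ) * (s / d) ^ q = N * t ^ q := by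
      have : t = n * (s / d) := by rw [ht]; ring
      rw [this, Real.mul_rpow (by positivity) (by positivity), ← mul_assoc, hN, ← hqa,
        ← Real.rpow_add (by linarith)]
      simp
    have h6 : d / n * t = s := by rw [ht]; field_simp
    have h7 : (n : ℝ) * (d * p) ≤ d * (n * (s / d) ^ q) := by
      have := mul_le_mul_of_nonneg_left hps (show (0 : ℝ) ≤ n * d by positivity)
      linarith
    have h8 := mul_le_mul_of_nonneg_left hp (show (0 : ℝ) ≤ n by positivity)
    rw [h5] at h7
    rw [h6]
    have : (m : ℝ) * v = n * v - v := by rw [hn]; ring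
    rw [this]
    linarith
  have h5 := mul_exp_neg_le (t := t)
  have h6 := rpow_mul_exp_neg_le ht0 hq0 hq2
  have h7 : 1 / (n : ℝ) ≤ N := by
    rw [hN, one_div, ← Real.rpow_neg_one]
    refine Real.rpow_le_rpow_of_exponent_le hn1 (neg_le_neg ?_)
    rw [div_le_one hd1]; linarith
  have h8 : Real.exp (-(m * v)) * (n * s - m * v) ≤
      Real.exp 1 * Real.exp (-t) * (d * N * t ^ q + d / n * t) := by
    refine mul_le_mul h3 h4 ?_ (by positivity)
    rw [hn]; nlinarith
  have h9 : (n : ℝ) / (2 * d) * s = t / 2 := by rw [ht]; field_simp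
  rw [h9]
  have h10 : d * N * (t ^ q * Real.exp (-t)) ≤ d * N * (9 * Real.exp (-(t / 2))) :=
    mul_le_mul_of_nonneg_left h6 (by positivity)
  have h11 : d * (1 / n) * (t * Real.exp (-t)) ≤ d * N * (2 * Real.exp (-(t / 2))) := by
    refine mul_le_mul ?_ h5 (by positivity) (by positivity)
    exact mul_le_mul_of_nonneg_left h7 (by positivity)
  -- The constant `11` is `9 + 2`, from `rpow_mul_exp_neg_le` and `mul_exp_neg_le`.
  have h12 : Real.exp 1 * Real.exp (-t) * (d * N * t ^ q + d / n * t) ≤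
      11 * Real.exp 1 * d * N * Real.exp (-(t / 2)) := by
    have e : Real.exp 1 * Real.exp (-t) * (d * N * t ^ q + d / n * t) = Real.exp 1 *
        (d * N * (t ^ q * Real.exp (-t)) + d * (1 / n) * (t * Real.exp (-t))) := by ring
    have := mul_le_mul_of_nonneg_left (add_le_add h10 h11) (Real.exp_pos 1).le
    rw [e]; linarith
  linarith

/-- The arithmetic-geometric mean inequality for the products of all but one coordinate. -/
theorem prod_le_leaveOneOutSum_div_rpow {d : ℕ} (hd : 2 ≤ d) {x : Fin d → ℝ}
    (hx : ∀ i, 0 < x i) :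
    ∏ i, x i ≤ (leaveOneOutSum x / d) ^ ((d : ℝ) / ((d : ℝ) - 1)) := by
  have hd' : (2 : ℝ) ≤ d := by exact_mod_cast hd
  have hd1 : 0 < (d : ℝ) - 1 := by linarith
  have hP : 0 < ∏ i, x i := Finset.prod_pos fun i _ => hx i
  have hz : ∀ j, ∏ i ∈ Finset.univ.erase j, x i = (∏ i, x i) / x j := fun j => by
    rw [eq_div_iff (hx j).ne', mul_comm, Finset.mul_prod_erase _ _ (Finset.mem_univ j)]
  have h := Real.geom_mean_le_arith_mean_weighted Finset.univ (fun _ : Fin d => 1 / (d : ℝ))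
    (fun j => ∏ i ∈ Finset.univ.erase j, x i) (fun _ _ => by positivity)
    (by simp; field_simp) (fun j _ => Finset.prod_nonneg fun i _ => (hx i).le)
  -- Each coordinate occurs in exactly `d - 1` of the leave-one-out products.
  have h1 : ∏ j, (∏ i ∈ Finset.univ.erase j, x i) = (∏ i, x i) ^ ((d : ℝ) - 1) := by
    simp only [hz]
    rw [Finset.prod_div_distrib, Real.rpow_sub_one hP.ne']
    simp
  rw [Real.finsetProd_rpow _ _ (fun j _ => Finset.prod_nonneg fun i _ => (hx i).le), h1,
    ← Real.rpow_mul hP.le, ← Finset.mul_sum] at h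
  have h2 := Real.rpow_le_rpow (Real.rpow_nonneg hP.le _) h
    (show 0 ≤ (d : ℝ) / ((d : ℝ) - 1) by positivity)
  rw [← Real.rpow_mul hP.le,
    show ((d : ℝ) - 1) * (1 / d) * (d / ((d : ℝ) - 1)) = 1 by field_simp, Real.rpow_one] at h2
  rwa [one_div, ← div_eq_inv_mul] at h2

/-! ### The expectation as an integral over the cube -/

/-- The uniform distribution on the unit cube. -/
noncomputable def cubeMeasure (d : ℕ) : Measure (Fin d → ℝ) := volume.restrict (Set.Icc 0 1)

theorem volume_unitCube (d : ℕ) : volume (Set.Icc (0 : Fin d → ℝ) 1) = 1 := by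
  simp [Real.volume_Icc_pi]

instance (d : ℕ) : IsProbabilityMeasure (cubeMeasure d) :=
  ⟨by rw [cubeMeasure, Measure.restrict_apply_univ, volume_unitCube]⟩

theorem measurableSet_kDominates (d k : ℕ) :
    MeasurableSet {p : (Fin d → ℝ) × (Fin d → ℝ) | KDominates k p.1 p.2} := by
  have h : {p : (Fin d → ℝ) × (Fin d → ℝ) | KDominates k p.1 p.2} =
      ⋃ S : Finset (Fin d), ⋃ _ : S.card = k,
        (⋂ j ∈ S, {p | p.1 j ≤ p.2 j}) ∩ ⋃ j ∈ S, {p | p.1 j < p.2 j} := by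
    ext p
    simp only [KDominates, Set.mem_ofPred_eq, Set.mem_iUnion, Set.mem_inter_iff, Set.mem_iInter,
      exists_prop]
  rw [h]
  refine MeasurableSet.iUnion fun S => MeasurableSet.iUnion fun _ => MeasurableSet.inter ?_ ?_
  · exact Finset.measurableSet_biInter _ fun j _ => measurableSet_le (by fun_prop) (by fun_prop)
  · exact Finset.measurableSet_biUnion _ fun j _ => measurableSet_lt (by fun_prop) (by fun_prop)

/-- The probability that a uniform point of the cube `k`-dominates `x`. -/
noncomputable def dominationProb {d : ℕ} (k : ℕ) (x : Fin d → ℝ) : ℝ :=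
  (cubeMeasure d).real {p | KDominates k p x}

theorem measurableSet_kDominates_left {d : ℕ} (k : ℕ) (x : Fin d → ℝ) :
    MeasurableSet {p : Fin d → ℝ | KDominates k p x} :=
  (measurableSet_kDominates d k).preimage (measurable_prodMk_right (y := x))

/-- Conditionally on the value `x` of the `i`-th point, the other `m` points fail to dominate it
independently, each with probability `1 - dominationProb k x`. -/
theorem pi_measure_not_kDominates {d m k : ℕ} (i : Fin (m + 1)) :
    Measure.pi (fun _ : Fin (m + 1) => cubeMeasure d)
      {p | ∀ j, j ≠ i → ¬ KDominates k (p j) (p i)} =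
    ∫⁻ x in Set.Icc (0 : Fin d → ℝ) 1, ENNReal.ofReal ((1 - dominationProb k x) ^ m) := by
  set A : Set ((Fin d → ℝ) × (Fin m → Fin d → ℝ)) :=
    {z | ∀ j, ¬ KDominates k (z.2 j) z.1} with hA
  have hAm : MeasurableSet A := by
    have : A = ⋂ j, (fun z : (Fin d → ℝ) × (Fin m → Fin d → ℝ) => (z.2 j, z.1)) ⁻¹'
        {p | KDominates k p.1 p.2}ᶜ := by
      ext z; simp [hA]
    rw [this]
    refine MeasurableSet.iInter fun j => (measurableSet_kDominates d k).compl.preimage ?_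
    fun_prop
  have hmp := measurePreserving_piFinSuccAbove (fun _ : Fin (m + 1) => cubeMeasure d) i
  have hpre : {p : Fin (m + 1) → Fin d → ℝ | ∀ j, j ≠ i → ¬ KDominates k (p j) (p i)} =
      MeasurableEquiv.piFinSuccAbove (fun _ => Fin d → ℝ) i ⁻¹' A := by
    ext p
    simp only [Set.mem_ofPred_eq, hA, Set.mem_preimage]
    constructor
    · intro h j
      exact h _ (Fin.succAbove_ne i j)
    · intro h j hj
      obtain ⟨l, rfl⟩ := Fin.exists_succAbove_eq hj
      exact h l
  rw [hpre, hmp.measure_preimage hAm.nullMeasurableSet, Measure.prod_apply hAm]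
  change ∫⁻ x, _ ∂(volume.restrict (Set.Icc 0 1)) = _
  refine lintegral_congr fun x => ?_
  have h1 : Prod.mk x ⁻¹' A = Set.univ.pi fun _ : Fin m => {p | KDominates k p x}ᶜ := by
    ext z; simp [hA]
  have h2 : (cubeMeasure d) {p | KDominates k p x}ᶜ =
      ENNReal.ofReal (1 - dominationProb k x) := by
    rw [dominationProb, ← probReal_compl_eq_one_sub (measurableSet_kDominates_left k x),
      ofReal_measureReal]
  have h3 : 0 ≤ 1 - dominationProb k x := by
    have : dominationProb k x ≤ 1 := measureReal_le_one
    linarith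
  rw [h1, Measure.pi_pi]
  simp [h2, ENNReal.ofReal_pow h3]

/-- The expected number of `k`-dominant skyline points as an integral over the cube. -/
theorem integral_kSkylineCount {Ω : Type*} [MeasurableSpace Ω] (P : Measure Ω)
    [IsProbabilityMeasure P] {d m k : ℕ} (X : Fin (m + 1) → Ω → Fin d → ℝ) (hX : iIndepFun X P)
    (hU : ∀ i, pdf.IsUniform (X i) (Set.Icc 0 1) P volume) :
    ∫ ω, (kSkylineCount k (fun i => X i ω) : ℝ) ∂P = ((m + 1 : ℕ) : ℝ) *
      (∫⁻ x in Set.Icc (0 : Fin d → ℝ) 1,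
        ENNReal.ofReal ((1 - dominationProb k x) ^ m)).toReal := by
  have hae : ∀ i, AEMeasurable (X i) P := fun i =>
    pdf.IsUniform.aemeasurable (by rw [volume_unitCube]; simp) (by rw [volume_unitCube]; simp)
      (hU i)
  have hlaw : ∀ i, Measure.map (X i) P = cubeMeasure d := fun i => by
    rw [hU i, ProbabilityTheory.cond, volume_unitCube]
    simp [cubeMeasure]
  have hmap := (iIndepFun_iff_map_fun_eq_pi_map hae).1 hX
  simp only [hlaw] at hmap
  set A : Fin (m + 1) → Set (Fin (m + 1) → Fin d → ℝ) := fun i =>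
    {p | ∀ j, j ≠ i → ¬ KDominates k (p j) (p i)} with hA
  have hAm : ∀ i, MeasurableSet (A i) := fun i => by
    have : A i = ⋂ j, ⋂ _ : j ≠ i, (fun p : Fin (m + 1) → Fin d → ℝ => (p j, p i)) ⁻¹'
        {p | KDominates k p.1 p.2}ᶜ := by
      ext z; simp [hA]
    rw [this]
    refine MeasurableSet.iInter fun j => MeasurableSet.iInter fun _ =>
      (measurableSet_kDominates d k).compl.preimage ?_
    fun_prop
  have hcount : ∀ p : Fin (m + 1) → Fin d → ℝ, (kSkylineCount k p : ℝ) =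
      ∑ i, (A i).indicator (fun _ => (1 : ℝ)) p := by
    classical
    intro p
    have : {i : Fin (m + 1) | ∀ j, j ≠ i → ¬ KDominates k (p j) (p i)} =
        ↑(Finset.univ.filter fun i => p ∈ A i) := by
      ext i; simp [hA]
    rw [kSkylineCount, this, Set.ncard_coe_finset, Finset.card_filter]
    push_cast
    refine Finset.sum_congr rfl fun i _ => ?_
    rw [Set.indicator_apply]
  have hmeas : Measurable fun p : Fin (m + 1) → Fin d → ℝ => (kSkylineCount k p : ℝ) := by
    simp only [hcount]
    exact Finset.measurable_sum _ fun i _ => measurable_const.indicator (hAm i)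
  have haeX : AEMeasurable (fun ω i => X i ω) P := aemeasurable_pi_lambda _ hae
  rw [← integral_map (f := fun p : Fin (m + 1) → Fin d → ℝ => (kSkylineCount k p : ℝ)) haeX
    hmeas.aestronglyMeasurable, hmap]
  simp only [hcount]
  rw [integral_finsetSum _ fun i _ => (integrable_const (1 : ℝ)).indicator (hAm i)]
  have hint : ∀ i, ∫ p, (A i).indicator (fun _ => (1 : ℝ)) p
      ∂(Measure.pi fun _ : Fin (m + 1) => cubeMeasure d) =
      (∫⁻ x in Set.Icc (0 : Fin d → ℝ) 1,
        ENNReal.ofReal ((1 - dominationProb k x) ^ m)).toReal := fun i => by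
    rw [integral_indicator_const _ (hAm i), smul_eq_mul, mul_one, Measure.real, hA]
    exact congrArg ENNReal.toReal (pi_measure_not_kDominates i)
  simp only [hint]
  simp

/-! ### Bounds for the domination probability -/

theorem cubeMeasure_real_pi_Ioo {d : ℕ} {a b : Fin d → ℝ} (ha : ∀ i, 0 ≤ a i)
    (hab : ∀ i, a i ≤ b i) (hb : ∀ i, b i ≤ 1) :
    (cubeMeasure d).real (Set.univ.pi fun i => Set.Ioo (a i) (b i)) = ∏ i, (b i - a i) := by
  have h : Set.univ.pi (fun i => Set.Ioo (a i) (b i)) ⊆ Set.Icc (0 : Fin d → ℝ) 1 := by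
    intro p hp
    rw [Set.mem_univ_pi] at hp
    exact ⟨fun i => (ha i).trans (hp i).1.le, fun i => (hp i).2.le.trans (hb i)⟩
  rw [Measure.real, cubeMeasure, Measure.restrict_eq_self _ h, Real.volume_pi_Ioo,
    ENNReal.toReal_prod]
  exact Finset.prod_congr rfl fun i _ => ENNReal.toReal_ofReal (by linarith [hab i])

theorem kDominates_of_forall_ne_lt {d : ℕ} (hd : 2 ≤ d) {p x : Fin d → ℝ} (j : Fin d)
    (h : ∀ i, i ≠ j → p i < x i) : KDominates (d - 1) p x := by
  refine ⟨Finset.univ.erase j, by simp, fun i hi => (h i (Finset.ne_of_mem_erase hi)).le, ?_⟩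
  have : (Finset.univ.erase j).Nonempty := by
    rw [← Finset.card_pos]; simp; omega
  obtain ⟨i, hi⟩ := this
  exact ⟨i, hi, h i (Finset.ne_of_mem_erase hi)⟩

/-- The complement of a set of `d - 1` coordinates is a single index. Strictness is discarded, which
is harmless for an upper bound on volume. -/
theorem exists_forall_ne_le_of_kDominates {d : ℕ} (hd : 2 ≤ d) {p x : Fin d → ℝ}
    (h : KDominates (d - 1) p x) : ∃ j, ∀ i, i ≠ j → p i ≤ x i := by
  obtain ⟨S, hS, hle, -⟩ := h
  have hc : Sᶜ.card = 1 := by rw [Finset.card_compl, hS, Fintype.card_fin]; omega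
  obtain ⟨j, hj⟩ := Finset.card_eq_one.1 hc
  refine ⟨j, fun i hi => hle i ?_⟩
  by_contra hiS
  have : i ∈ Sᶜ := Finset.mem_compl.2 hiS
  rw [hj, Finset.mem_singleton] at this
  exact hi this

theorem prod_ite_eq_erase {d : ℕ} (x : Fin d → ℝ) (j : Fin d) (c : ℝ) :
    ∏ i, (if i = j then c else x i) = c * ∏ i ∈ Finset.univ.erase j, x i := by
  rw [← Finset.mul_prod_erase _ _ (Finset.mem_univ j)]
  simp only [if_true]
  congr 1
  exact Finset.prod_congr rfl fun i hi => if_neg (Finset.ne_of_mem_erase hi)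

theorem prod_erase_le_dominationProb {d : ℕ} (hd : 2 ≤ d) {x : Fin d → ℝ} (hx : ∀ i, 0 < x i)
    (hx1 : ∀ i, x i ≤ 1) (j : Fin d) :
    ∏ i ∈ Finset.univ.erase j, x i ≤ dominationProb (d - 1) x := by
  have h := cubeMeasure_real_pi_Ioo (a := fun _ => 0) (b := fun i => if i = j then 1 else x i)
    (fun _ => le_rfl) (fun i => by split_ifs; exacts [zero_le_one, (hx i).le])
    (fun i => by split_ifs; exacts [le_rfl, hx1 i])
  simp only [sub_zero, prod_ite_eq_erase, one_mul] at h
  rw [← h]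
  refine measureReal_mono fun p hp => kDominates_of_forall_ne_lt hd j fun i hi => ?_
  have := (Set.mem_univ_pi.1 hp i).2
  rwa [if_neg hi] at this

theorem leaveOneOutSum_le_mul_dominationProb {d : ℕ} (hd : 2 ≤ d) {x : Fin d → ℝ}
    (hx : ∀ i, 0 < x i) (hx1 : ∀ i, x i ≤ 1) :
    leaveOneOutSum x ≤ d * dominationProb (d - 1) x := by
  have := Finset.sum_le_sum fun j (_ : j ∈ Finset.univ) =>
    prod_erase_le_dominationProb hd hx hx1 j
  simpa [leaveOneOutSum] using this

/-- Union bound over the coordinate that is allowed to be large. -/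
theorem dominationProb_le_leaveOneOutSum {d : ℕ} (hd : 2 ≤ d) {x : Fin d → ℝ}
    (hx : ∀ i, 0 < x i) :
    dominationProb (d - 1) x ≤ leaveOneOutSum x := by
  have hsub : {p | KDominates (d - 1) p x} ⊆ ⋃ j, {p : Fin d → ℝ | ∀ i, i ≠ j → p i ≤ x i} := by
    intro p hp
    obtain ⟨j, hj⟩ := exists_forall_ne_le_of_kDominates hd hp
    exact Set.mem_iUnion.2 ⟨j, hj⟩
  refine (measureReal_mono hsub).trans ((measureReal_iUnion_fintype_le _).trans
    (Finset.sum_le_sum fun j _ => ?_))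
  have h : {p : Fin d → ℝ | ∀ i, i ≠ j → p i ≤ x i} ∩ Set.Icc 0 1 ⊆
      Set.Icc 0 (fun i => if i = j then 1 else x i) := by
    rintro p ⟨hp, hp0, hp1⟩
    refine ⟨hp0, fun i => ?_⟩
    dsimp only
    split_ifs with hi
    exacts [hp1 i, hp i hi]
  have hm : MeasurableSet {p : Fin d → ℝ | ∀ i, i ≠ j → p i ≤ x i} := by
    simp only [Set.ofPred_forall]
    exact MeasurableSet.iInter fun i => MeasurableSet.iInter fun _ =>
      measurableSet_le (measurable_pi_apply i) measurable_const
  have hv : volume (Set.Icc (0 : Fin d → ℝ) (fun i => if i = j then 1 else x i)) =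
      ENNReal.ofReal (∏ i ∈ Finset.univ.erase j, x i) := by
    rw [Real.volume_Icc_pi, ← ENNReal.ofReal_prod_of_nonneg]
    · simp only [Pi.zero_apply, sub_zero, prod_ite_eq_erase, one_mul]
    · intro i _
      simp only [Pi.zero_apply, sub_zero]
      split_ifs
      exacts [zero_le_one, (hx i).le]
  rw [Measure.real, cubeMeasure, Measure.restrict_apply hm]
  refine ENNReal.toReal_le_of_le_ofReal (Finset.prod_nonneg fun i _ => (hx i).le) ?_
  rw [← hv]
  exact measure_mono h

/-- Requiring the exceptional coordinate to exceed `x j` makes the boxes disjoint, so their volumes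
add; each box loses `∏ i, x i` by this restriction. -/
theorem leaveOneOutSum_sub_le_dominationProb {d : ℕ} (hd : 2 ≤ d) {x : Fin d → ℝ}
    (hx : ∀ i, 0 < x i) (hx1 : ∀ i, x i ≤ 1) :
    leaveOneOutSum x - d * ∏ i, x i ≤ dominationProb (d - 1) x := by
  set B : Fin d → Set (Fin d → ℝ) := fun j => Set.univ.pi fun i =>
    Set.Ioo (if i = j then x i else 0) (if i = j then 1 else x i) with hB
  have hBv : ∀ j, (cubeMeasure d).real (B j) =
      ∏ i ∈ Finset.univ.erase j, x i - ∏ i, x i := fun j => by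
    rw [hB, cubeMeasure_real_pi_Ioo]
    · have h : ∀ i, ((if i = j then 1 else x i) - if i = j then x i else 0) =
          if i = j then 1 - x j else x i := fun i => by
        split_ifs with hi
        · rw [hi]
        · ring
      simp only [h, prod_ite_eq_erase]
      rw [← Finset.mul_prod_erase _ _ (Finset.mem_univ j)]
      ring
    · intro i; split_ifs; exacts [(hx i).le, le_rfl]
    · intro i; split_ifs; exacts [hx1 i, (hx i).le]
    · intro i; split_ifs; exacts [le_rfl, hx1 i]
  have hdisj : Pairwise (Function.onFun Disjoint B) := by
    intro j l hjl
    refine Set.disjoint_left.2 fun p hp hq => ?_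
    have h1 := (Set.mem_univ_pi.1 hp j).1
    have h2 := (Set.mem_univ_pi.1 hq j).2
    rw [if_pos rfl] at h1
    rw [if_neg hjl] at h2
    exact lt_asymm h1 h2
  have hBm : ∀ j, MeasurableSet (B j) := fun j => MeasurableSet.univ_pi fun i => measurableSet_Ioo
  have hsub : (⋃ j, B j) ⊆ {p | KDominates (d - 1) p x} := by
    intro p hp
    obtain ⟨j, hj⟩ := Set.mem_iUnion.1 hp
    refine kDominates_of_forall_ne_lt hd j fun i hi => ?_
    have := (Set.mem_univ_pi.1 hj i).2
    rwa [if_neg hi] at this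
  have h := measureReal_mono (μ := cubeMeasure d) hsub
  rw [measureReal_iUnion_fintype hdisj hBm] at h
  simp only [hBv, Finset.sum_sub_distrib] at h
  simpa [leaveOneOutSum, dominationProb] using h

/-! ### Gamma-function estimates and absorption of powers of `d` -/

/-- Log-convexity of Gamma, applied with `1` as a weighted mean of `1 + a` and `1 / 2`, together
with `Γ (1 / 2) ^ 2 = π ≤ 4`. -/
theorem four_rpow_neg_le_Gamma_one_add {a : ℝ} (ha : 0 < a) :
    (4 : ℝ) ^ (-a) ≤ Real.Gamma (1 + a) := by
  have hG : 0 < Real.Gamma (1 + a) := Real.Gamma_pos_of_pos (by linarith)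
  have hH : 0 < Real.Gamma (1 / 2) := Real.Gamma_pos_of_pos (by norm_num)
  have hH2 : Real.Gamma (1 / 2) ≤ 2 := by
    rw [Real.Gamma_one_half_eq, Real.sqrt_le_left (by norm_num)]
    linarith [Real.pi_le_four]
  have h := Real.Gamma_mul_add_mul_le_rpow_Gamma_mul_rpow_Gamma (s := 1 + a) (t := 1 / 2)
    (a := 1 / (1 + 2 * a)) (b := 2 * a / (1 + 2 * a)) (by linarith) (by norm_num)
    (by positivity) (by positivity) (by field_simp)
  rw [show 1 / (1 + 2 * a) * (1 + a) + 2 * a / (1 + 2 * a) * (1 / 2) = 1 by field_simp; ring,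
    Real.Gamma_one] at h
  have h1 := Real.rpow_le_rpow zero_le_one h (show 0 ≤ 1 + 2 * a by linarith)
  rw [Real.one_rpow, Real.mul_rpow (by positivity) (by positivity), ← Real.rpow_mul hG.le,
    ← Real.rpow_mul hH.le, show 1 / (1 + 2 * a) * (1 + 2 * a) = 1 by field_simp,
    show 2 * a / (1 + 2 * a) * (1 + 2 * a) = 2 * a by field_simp, Real.rpow_one] at h1
  have h2 : Real.Gamma (1 / 2) ^ (2 * a) ≤ 4 ^ a := by
    refine (Real.rpow_le_rpow hH.le hH2 (by linarith)).trans (le_of_eq ?_)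
    rw [Real.rpow_mul (by norm_num), Real.rpow_two]; norm_num
  rw [Real.rpow_neg (by norm_num), inv_le_iff_one_le_mul₀ (Real.rpow_pos_of_pos (by norm_num) _)]
  exact h1.trans (mul_le_mul_of_nonneg_left h2 hG.le)

theorem Gamma_one_add_le_one {b : ℝ} (hb0 : 0 ≤ b) (hb1 : b ≤ 1) : Real.Gamma (1 + b) ≤ 1 := by
  have h := Real.convexOn_Gamma.2 (x := 1) (y := 2) (by simp) (by simp)
    (show 0 ≤ 1 - b by linarith) hb0 (by ring)
  simp only [smul_eq_mul, Real.Gamma_one, Real.Gamma_two] at h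
  rw [show (1 - b) * 1 + b * 2 = 1 + b by ring] at h
  linarith

/-- Both sides are compared with `e ^ (e + 1)`, since `Γ (1 / k)` is close to `k`. The loss is `4 ^
(1 + 1 / e) ≤ 16`. This compares the Gamma factors of dimensions `e` and `e + 1` in the tail. -/
theorem mul_Gamma_pow_le {e : ℕ} (he : 2 ≤ e) :
    (e : ℝ) * Real.Gamma (1 / ((e : ℝ) - 1)) ^ e ≤ 16 * Real.Gamma (1 / (e : ℝ)) ^ (e + 1) := by
  have he' : (2 : ℝ) ≤ e := by exact_mod_cast he
  have he1 : 0 < (e : ℝ) - 1 := by linarith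
  have h1 : Real.Gamma (1 / ((e : ℝ) - 1)) ≤ e := by
    have h := Real.Gamma_add_one (s := 1 / ((e : ℝ) - 1)) (by positivity)
    have h2 := Gamma_one_add_le_one (b := 1 / ((e : ℝ) - 1)) (by positivity)
      (by rw [div_le_one he1]; linarith)
    rw [add_comm, h, one_div, inv_mul_le_iff₀ he1] at h2
    rw [one_div]
    linarith
  have h2 : (e : ℝ) * 4 ^ (-(1 / (e : ℝ))) ≤ Real.Gamma (1 / (e : ℝ)) := by
    have h := Real.Gamma_add_one (s := 1 / (e : ℝ)) (by positivity)
    have h3 := four_rpow_neg_le_Gamma_one_add (a := 1 / (e : ℝ)) (by positivity)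
    rw [add_comm, h] at h3
    have h4 := mul_le_mul_of_nonneg_left h3 (show (0 : ℝ) ≤ e by linarith)
    rwa [← mul_assoc, mul_one_div_cancel (by linarith), one_mul] at h4
  have h3 : (1 : ℝ) ≤ 16 * (4 ^ (-(1 / (e : ℝ)))) ^ (e + 1) := by
    rw [← Real.rpow_natCast, ← Real.rpow_mul (by norm_num),
      show (16 : ℝ) = 4 ^ (2 : ℝ) by rw [Real.rpow_two]; norm_num,
      ← Real.rpow_add (by norm_num)]
    refine Real.one_le_rpow (by norm_num) ?_
    have : 1 / (e : ℝ) ≤ 1 := by rw [div_le_one (by linarith)]; linarith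
    have h5 : -(1 / (e : ℝ)) * ((e + 1 : ℕ) : ℝ) = -1 - 1 / (e : ℝ) := by
      push_cast; field_simp; ring
    rw [h5]; linarith
  have hG : 0 ≤ Real.Gamma (1 / ((e : ℝ) - 1)) := (Real.Gamma_pos_of_pos (by positivity)).le
  calc (e : ℝ) * Real.Gamma (1 / ((e : ℝ) - 1)) ^ e ≤ e * (e : ℝ) ^ e :=
        mul_le_mul_of_nonneg_left (pow_le_pow_left₀ hG h1 e) (by linarith)
    _ = (e : ℝ) ^ (e + 1) * 1 := by ring
    _ ≤ (e : ℝ) ^ (e + 1) * (16 * (4 ^ (-(1 / (e : ℝ)))) ^ (e + 1)) :=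
        mul_le_mul_of_nonneg_left h3 (by positivity)
    _ = 16 * (e * 4 ^ (-(1 / (e : ℝ)))) ^ (e + 1) := by rw [mul_pow]; ring
    _ ≤ _ := mul_le_mul_of_nonneg_left (pow_le_pow_left₀ (by positivity) h2 _) (by norm_num)

/-- The two powers of `n` differ by the exponent `(d - 3) / ((d - 1) * (d - 2))`. As `(d - 1) * (d -
2) ≤ 2 * log n`, that power is at least `exp ((d - 3) / 2)`, which dominates `d ^ 2` up to a
constant. -/
theorem sq_mul_rpow_neg_le {d : ℝ} (hd : 3 ≤ d) {n : ℝ} (hn : 1 ≤ n)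
    (hdn : d ^ 2 ≤ 2 * Real.log n) :
    d ^ 2 * n ^ (-(1 / (d - 1))) ≤ 34 * n ^ (-(1 / ((d - 1) * (d - 2)))) := by
  have hn0 : 0 < n := by linarith
  have h1 : 0 < d - 1 := by linarith
  have h2 : 0 < d - 2 := by linarith
  have h : d ^ 2 ≤ 34 * n ^ ((d - 3) / ((d - 1) * (d - 2))) := by
    have h3 : Real.exp ((d - 3) / 2) ≤ n ^ ((d - 3) / ((d - 1) * (d - 2))) := by
      rw [Real.rpow_def_of_pos hn0]
      refine Real.exp_le_exp.2 ?_
      rw [← mul_div_assoc, div_le_div_iff₀ (by norm_num) (by positivity)]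
      have : (d - 1) * (d - 2) ≤ Real.log n * 2 := by nlinarith
      nlinarith [mul_le_mul_of_nonneg_left this (show 0 ≤ d - 3 by linarith)]
    have h4 := Real.quadratic_le_exp_of_nonneg (show 0 ≤ (d - 3) / 2 by linarith)
    nlinarith [sq_nonneg (d - 3)]
  have h3 := mul_le_mul_of_nonneg_right h (Real.rpow_nonneg hn0.le (-(1 / (d - 1))))
  have h4 : (d - 3) / ((d - 1) * (d - 2)) + -(1 / (d - 1)) = -(1 / ((d - 1) * (d - 2))) := by
    have h1' := h1.ne'
    have h2' := h2.ne'
    field_simp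
    ring
  rwa [mul_assoc 34, ← Real.rpow_add hn0, h4] at h3

/-! ### Comparison of the cube integral with the Laplace transform -/

/-- The value of the Laplace transform of `leaveOneOutSum` on the positive orthant at `r`. -/
noncomputable def leaveOneOutLaplace (d : ℕ) (r : ℝ) : ℝ :=
  1 / ((d : ℝ) - 1) * (1 / r) ^ ((d : ℝ) / ((d : ℝ) - 1)) * Real.Gamma (1 / ((d : ℝ) - 1)) ^ d

theorem leaveOneOutLaplace_pos {d : ℕ} (hd : 2 ≤ d) {r : ℝ} (hr : 0 < r) :
    0 < leaveOneOutLaplace d r := by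
  have hd' : (2 : ℝ) ≤ d := by exact_mod_cast hd
  have hd1 : 0 < (d : ℝ) - 1 := by linarith
  have := Real.Gamma_pos_of_pos (show 0 < 1 / ((d : ℝ) - 1) by positivity)
  unfold leaveOneOutLaplace
  positivity

/-- The transform is homogeneous of degree `-d / (d - 1)`, and `d / (d - 1) ≤ 2`. -/
theorem leaveOneOutLaplace_div_le {d : ℕ} (hd : 2 ≤ d) {r c : ℝ} (hr : 0 < r) (hc : 1 ≤ c) :
    leaveOneOutLaplace d (r / c) ≤ c ^ 2 * leaveOneOutLaplace d r := by
  have hd' : (2 : ℝ) ≤ d := by exact_mod_cast hd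
  have hd1 : 0 < (d : ℝ) - 1 := by linarith
  have h : leaveOneOutLaplace d (r / c) =
      c ^ ((d : ℝ) / ((d : ℝ) - 1)) * leaveOneOutLaplace d r := by
    unfold leaveOneOutLaplace
    rw [show 1 / (r / c) = c * (1 / r) by field_simp,
      Real.mul_rpow (by linarith) (by positivity)]
    ring
  rw [h, ← Real.rpow_two]
  refine mul_le_mul_of_nonneg_right (Real.rpow_le_rpow_of_exponent_le hc ?_)
    (leaveOneOutLaplace_pos hd hr).le
  rw [div_le_iff₀ hd1]; linarith

theorem pi_Ioc_subset_posOrthant (d : ℕ) :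
    (Set.univ.pi fun _ : Fin d => Set.Ioc (0 : ℝ) 1) ⊆ posOrthant d :=
  Set.pi_mono fun _ _ _ h => h.1

theorem setLIntegral_unitCube_eq (d : ℕ) (f : (Fin d → ℝ) → ENNReal) :
    ∫⁻ x in Set.Icc 0 1, f x = ∫⁻ x in Set.univ.pi fun _ => Set.Ioc 0 1, f x :=
  setLIntegral_congr (Measure.univ_pi_Ioc_ae_eq_Icc (f := fun _ : Fin d => (0 : ℝ))
    (g := fun _ => 1)).symm

theorem measurableSet_pi_Ioc (d : ℕ) :
    MeasurableSet (Set.univ.pi fun _ : Fin d => Set.Ioc (0 : ℝ) 1) :=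
  MeasurableSet.univ_pi fun _ => measurableSet_Ioc

theorem lintegral_one_sub_dominationProb_pow_le {d m : ℕ} (hd : 3 ≤ d) :
    ∫⁻ x in Set.Icc (0 : Fin d → ℝ) 1, ENNReal.ofReal ((1 - dominationProb (d - 1) x) ^ m) ≤
      ENNReal.ofReal (leaveOneOutLaplace d (m + 1 : ℕ) +
        11 * Real.exp 1 * d * ((m + 1 : ℕ) : ℝ) ^ (-(1 / ((d : ℝ) - 1))) *
          leaveOneOutLaplace d ((m + 1 : ℕ) / (2 * d))) := by
  set n := m + 1 with hn
  have hn0 : (0 : ℝ) < n := by rw [hn]; positivity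
  have hd0 : (0 : ℝ) < d := by positivity
  set R : ℝ := 11 * Real.exp 1 * d * (n : ℝ) ^ (-(1 / ((d : ℝ) - 1))) with hR
  have hR0 : 0 ≤ R := by positivity
  have hcont := continuous_leaveOneOutSum d
  rw [setLIntegral_unitCube_eq, ENNReal.ofReal_add (leaveOneOutLaplace_pos (by omega) hn0).le
    (mul_nonneg hR0 (leaveOneOutLaplace_pos (by omega) (by positivity)).le),
    ENNReal.ofReal_mul hR0]
  unfold leaveOneOutLaplace
  rw [← lintegral_exp_neg_leaveOneOutSum (by omega) hn0,
    ← lintegral_exp_neg_leaveOneOutSum (by omega) (show 0 < (n : ℝ) / (2 * d) by positivity),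
    ← lintegral_const_mul' _ _ ENNReal.ofReal_ne_top, ← lintegral_add_left (by
      exact (ENNReal.continuous_ofReal.comp (by fun_prop)).measurable)]
  refine (setLIntegral_mono' (measurableSet_pi_Ioc d) fun x hx => ?_).trans
    (lintegral_mono_set (pi_Ioc_subset_posOrthant d))
  rw [Set.mem_univ_pi] at hx
  have hx0 : ∀ i, 0 < x i := fun i => (hx i).1
  rw [← ENNReal.ofReal_mul hR0, ← ENNReal.ofReal_add (Real.exp_pos _).le (by positivity)]
  refine ENNReal.ofReal_le_ofReal ?_
  exact one_sub_pow_le_exp_neg_add hd hn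
    (Finset.sum_nonneg fun j _ => Finset.prod_nonneg fun i _ => (hx0 i).le) measureReal_le_one
    (dominationProb_le_leaveOneOutSum (by omega) hx0)
    (leaveOneOutSum_le_mul_dominationProb (by omega) hx0 fun i => (hx i).2)
    (leaveOneOutSum_sub_le_dominationProb (by omega) hx0 fun i => (hx i).2)
    (prod_le_leaveOneOutSum_div_rpow (by omega) hx0)

/-- The orthant is covered by the cube and the `e + 1` regions where one coordinate exceeds `1`. The
Poisson lower bound handles the cube, and the `e`-dimensional transform each region. -/
theorem leaveOneOutLaplace_le_lintegral_add {e m : ℕ} (he : 2 ≤ e) :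
    ENNReal.ofReal (leaveOneOutLaplace (e + 1) (m + 1 : ℕ)) ≤
      (∫⁻ x in Set.Icc (0 : Fin (e + 1) → ℝ) 1, ENNReal.ofReal ((1 - dominationProb e x) ^ m)) +
      ENNReal.ofReal (8 / ((m + 1 : ℕ) : ℝ) * leaveOneOutLaplace (e + 1) ((m + 1 : ℕ) / 2) +
        ((e + 1 : ℕ) : ℝ) * ((1 / ((m + 1 : ℕ) : ℝ)) ^ ((e : ℝ) / ((e : ℝ) - 1)) *
          Real.Gamma (1 / ((e : ℝ) - 1)) ^ e)) := by
  set n := m + 1 with hn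
  have hn0 : (0 : ℝ) < n := by rw [hn]; positivity
  have he' : (2 : ℝ) ≤ e := by exact_mod_cast he
  have he1 : 0 < (e : ℝ) - 1 := by linarith
  have hG := Real.Gamma_pos_of_pos (show 0 < 1 / ((e : ℝ) - 1) by positivity)
  have hcont := continuous_leaveOneOutSum (e + 1)
  set F : (Fin (e + 1) → ℝ) → ENNReal := fun x =>
    ENNReal.ofReal (Real.exp (-(n * leaveOneOutSum x))) with hF
  have hcover : posOrthant (e + 1) ⊆ (Set.univ.pi fun _ => Set.Ioc (0 : ℝ) 1) ∪
      ⋃ j, posOrthant (e + 1) ∩ {x | 1 < x j} := by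
    intro x hx
    by_cases h : ∀ i, x i ≤ 1
    · exact Or.inl (Set.mem_univ_pi.2 fun i => ⟨mem_posOrthant.1 hx i, h i⟩)
    · push Not at h
      obtain ⟨j, hj⟩ := h
      exact Or.inr (Set.mem_iUnion.2 ⟨j, hx, hj⟩)
  have hcube : ∫⁻ x in Set.univ.pi fun _ => Set.Ioc (0 : ℝ) 1, F x ≤
      (∫⁻ x in Set.Icc (0 : Fin (e + 1) → ℝ) 1,
        ENNReal.ofReal ((1 - dominationProb e x) ^ m)) +
      ENNReal.ofReal (8 / (n : ℝ) * leaveOneOutLaplace (e + 1) (n / 2)) := by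
    have hc0 : (0 : ℝ) ≤ 8 / n := by positivity
    rw [setLIntegral_unitCube_eq, ENNReal.ofReal_mul hc0]
    unfold leaveOneOutLaplace
    rw [← lintegral_exp_neg_leaveOneOutSum (by omega) (show 0 < (n : ℝ) / 2 by positivity),
      ← lintegral_const_mul' _ _ ENNReal.ofReal_ne_top]
    refine le_trans ?_ (add_le_add le_rfl (lintegral_mono_set (pi_Ioc_subset_posOrthant _)))
    rw [← lintegral_add_right _ (by
      exact ((ENNReal.continuous_ofReal.comp (by fun_prop)).measurable).const_mul _)]
    refine setLIntegral_mono' (measurableSet_pi_Ioc _) fun x hx => ?_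
    rw [Set.mem_univ_pi] at hx
    have hx0 : ∀ i, 0 < x i := fun i => (hx i).1
    have hV1 : dominationProb e x ≤ 1 := measureReal_le_one
    rw [← ENNReal.ofReal_mul hc0, ← ENNReal.ofReal_add (pow_nonneg (by linarith) _)
      (by positivity)]
    refine ENNReal.ofReal_le_ofReal ?_
    exact exp_neg_mul_le_one_sub_pow_add n m (by omega) (by omega)
      (Finset.sum_nonneg fun j _ => Finset.prod_nonneg fun i _ => (hx0 i).le)
      (dominationProb_le_leaveOneOutSum (by omega) hx0) measureReal_nonneg hV1
  have htail : ∫⁻ x in ⋃ j, posOrthant (e + 1) ∩ {x | 1 < x j}, F x ≤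
      ENNReal.ofReal (((e + 1 : ℕ) : ℝ) * ((1 / (n : ℝ)) ^ ((e : ℝ) / ((e : ℝ) - 1)) *
          Real.Gamma (1 / ((e : ℝ) - 1)) ^ e)) := by
    refine (lintegral_iUnion_le _ _).trans ?_
    rw [tsum_fintype]
    refine (Finset.sum_le_sum fun j _ =>
      lintegral_exp_neg_leaveOneOutSum_tail_le he hn0 j).trans (le_of_eq ?_)
    rw [Finset.sum_const, Finset.card_univ, Fintype.card_fin, nsmul_eq_mul,
      ENNReal.ofReal_mul (Nat.cast_nonneg _), ENNReal.ofReal_natCast]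
  rw [ENNReal.ofReal_add (mul_nonneg (by positivity)
    (leaveOneOutLaplace_pos (by omega) (by positivity)).le) (by positivity), ← add_assoc]
  refine le_trans ?_ (add_le_add hcube htail)
  refine le_trans (le_of_eq ?_) ((lintegral_mono_set hcover).trans (lintegral_union_le _ _ _))
  exact (lintegral_exp_neg_leaveOneOutSum (by omega) hn0).symm

/-- The integral over the cube agrees with the Laplace transform up to a relative error. -/
theorem abs_lintegral_toReal_sub_leaveOneOutLaplace_le {e m : ℕ} (he : 2 ≤ e)
    (hlog : (((e + 1 : ℕ) : ℝ)) ^ 2 ≤ 2 * Real.log (m + 1 : ℕ)) :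
    |(∫⁻ x in Set.Icc (0 : Fin (e + 1) → ℝ) 1,
        ENNReal.ofReal ((1 - dominationProb e x) ^ m)).toReal -
      leaveOneOutLaplace (e + 1) (m + 1 : ℕ)| ≤
    4488 * (((e + 1 : ℕ) : ℝ) * ((m + 1 : ℕ) : ℝ) ^ (-(1 / ((e : ℝ) * ((e : ℝ) - 1))))) *
      leaveOneOutLaplace (e + 1) (m + 1 : ℕ) := by
  have hup := lintegral_one_sub_dominationProb_pow_le (d := e + 1) (m := m) (by omega)
  have hlow := leaveOneOutLaplace_le_lintegral_add (e := e) (m := m) he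
  rw [Nat.add_sub_cancel] at hup
  set I := ∫⁻ x in Set.Icc (0 : Fin (e + 1) → ℝ) 1,
    ENNReal.ofReal ((1 - dominationProb e x) ^ m) with hI
  set n : ℕ := m + 1 with hn
  set d : ℕ := e + 1 with hd
  have hn1 : (1 : ℝ) ≤ n := by rw [hn]; push_cast; linarith [Nat.cast_nonneg (α := ℝ) m]
  have hn0 : (0 : ℝ) < n := by linarith
  have he' : (2 : ℝ) ≤ e := by exact_mod_cast he
  have he1 : 0 < (e : ℝ) - 1 := by linarith
  have hde : (d : ℝ) - 1 = e := by rw [hd]; push_cast; ring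
  have hd3 : (3 : ℝ) ≤ d := by linarith
  have hIne : I ≠ ⊤ := ne_top_of_le_ne_top ENNReal.ofReal_ne_top hup
  set N : ℝ := (n : ℝ) ^ (-(1 / ((e : ℝ) * ((e : ℝ) - 1)))) with hN
  have hN0 : 0 < N := Real.rpow_pos_of_pos hn0 _
  set A := leaveOneOutLaplace d n with hA
  have hA0 : 0 < A := leaveOneOutLaplace_pos (by omega) hn0
  have hA2 := leaveOneOutLaplace_div_le (d := d) (by omega) hn0 (show (1 : ℝ) ≤ 2 by norm_num)
  have hA3 := leaveOneOutLaplace_div_le (d := d) (by omega) hn0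
    (show (1 : ℝ) ≤ 2 * d by linarith)
  have hB2 := leaveOneOutLaplace_pos (d := d) (by omega) (show (0 : ℝ) < n / 2 by positivity)
  have hB3 := leaveOneOutLaplace_pos (d := d) (by omega)
    (show (0 : ℝ) < n / (2 * d) by positivity)
  have hinv : 1 / (n : ℝ) ≤ N := by
    rw [hN, one_div, ← Real.rpow_neg_one]
    refine Real.rpow_le_rpow_of_exponent_le hn1 (neg_le_neg ?_)
    rw [div_le_one (by positivity)]; nlinarith
  rw [abs_sub_le_iff]
  constructor
  · have h1 := ENNReal.toReal_le_of_le_ofReal (by positivity) hup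
    have h2 := sq_mul_rpow_neg_le hd3 hn1 hlog
    rw [show (d : ℝ) - 2 = e - 1 by linarith, hde, ← hN] at h2
    rw [hde] at h1
    -- Here `4488 = 11 * 3 * 4 * 34`: `3` bounds `exp 1`, `4 * d ^ 2` comes from rescaling by `2 *
    -- d`, and `34` from `sq_mul_rpow_neg_le`.
    have h3 : 11 * Real.exp 1 * d * (n : ℝ) ^ (-(1 / (e : ℝ))) *
        leaveOneOutLaplace d (n / (2 * d)) ≤ 4488 * (d * N) * A := by
      calc _ ≤ 11 * 3 * d * (n : ℝ) ^ (-(1 / (e : ℝ))) * ((2 * d) ^ 2 * A) := by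
            have := Real.exp_one_lt_three
            gcongr
        _ = 11 * 3 * 4 * d * A * (d ^ 2 * (n : ℝ) ^ (-(1 / (e : ℝ)))) := by ring
        _ ≤ 11 * 3 * 4 * d * A * (34 * N) := mul_le_mul_of_nonneg_left h2 (by positivity)
        _ = _ := by ring
    linarith
  · have hG := Real.Gamma_pos_of_pos (show 0 < 1 / ((e : ℝ) - 1) by positivity)
    have hT : (1 / (n : ℝ)) ^ ((e : ℝ) / ((e : ℝ) - 1)) * Real.Gamma (1 / ((e : ℝ) - 1)) ^ e ≤
        16 * N * A := by
      have h1 := mul_Gamma_pow_le he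
      -- The rate of the theorem arises here: `e / (e - 1) - (e + 1) / e = 1 / (e * (e - 1))`.
      have h2 : (1 / (n : ℝ)) ^ ((e : ℝ) / ((e : ℝ) - 1)) =
          N * (1 / (n : ℝ)) ^ ((d : ℝ) / (e : ℝ)) := by
        rw [hN, one_div, Real.inv_rpow hn0.le, Real.inv_rpow hn0.le, ← Real.rpow_neg hn0.le,
          ← Real.rpow_neg hn0.le, ← Real.rpow_add hn0, show (d : ℝ) = e + 1 by linarith]
        congr 1
        field_simp
        ring
      have h3 : A = 1 / (e : ℝ) * (1 / (n : ℝ)) ^ ((d : ℝ) / (e : ℝ)) *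
          Real.Gamma (1 / (e : ℝ)) ^ (e + 1) := by
        rw [hA, leaveOneOutLaplace, hde, hd]
      have h4 : Real.Gamma (1 / ((e : ℝ) - 1)) ^ e ≤
          1 / (e : ℝ) * (16 * Real.Gamma (1 / (e : ℝ)) ^ (e + 1)) := by
        rw [one_div (e : ℝ), le_inv_mul_iff₀ (by linarith)]
        rw [← one_div]
        exact h1
      rw [h2, h3]
      calc _ ≤ N * (1 / (n : ℝ)) ^ ((d : ℝ) / (e : ℝ)) *
            (1 / (e : ℝ) * (16 * Real.Gamma (1 / (e : ℝ)) ^ (e + 1))) :=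
            mul_le_mul_of_nonneg_left h4 (by positivity)
        _ = _ := by ring
    have h1 : A ≤ I.toReal + (8 / n * leaveOneOutLaplace d (n / 2) +
        d * ((1 / (n : ℝ)) ^ ((e : ℝ) / ((e : ℝ) - 1)) *
          Real.Gamma (1 / ((e : ℝ) - 1)) ^ e)) := by
      rw [← ENNReal.ofReal_toReal hIne, ← ENNReal.ofReal_add ENNReal.toReal_nonneg
        (by positivity)] at hlow
      exact (ENNReal.ofReal_le_ofReal_iff (by positivity)).1 hlow
    have h2 : 8 / n * leaveOneOutLaplace d (n / 2) ≤ 32 * (d * N) * A := by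
      calc 8 / (n : ℝ) * leaveOneOutLaplace d (n / 2) =
            8 * (1 / n) * leaveOneOutLaplace d (n / 2) := by ring
        _ ≤ 8 * N * (2 ^ 2 * A) := by gcongr
        _ = 32 * (1 * N) * A := by ring
        _ ≤ _ := by gcongr; linarith
    have h3 : d * ((1 / (n : ℝ)) ^ ((e : ℝ) / ((e : ℝ) - 1)) *
          Real.Gamma (1 / ((e : ℝ) - 1)) ^ e) ≤ 16 * (d * N) * A :=
      (mul_le_mul_of_nonneg_left hT (by positivity)).trans (le_of_eq (by ring))
    have h4 : 0 ≤ (d * N) * A := by positivity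
    linarith

/-! ### Assembly of the uniform estimate -/

/-- For independent uniform samples of `n` points of `[0,1]^d`, uniformly over all dimensions
`d ≥ 3` with `2 log n / d ^ 2 - W (2 log n) ≥ K n`, where `K n → ∞` is arbitrary. -/
theorem mainTheorem2 :
    ∃ C : ℝ, ∀ K : ℕ → ℝ, Tendsto K atTop atTop →
      ∀ᶠ n : ℕ in atTop, ∀ d : ℕ, 3 ≤ d →
        K n ≤ 2 * Real.log n / (d : ℝ) ^ 2 - lambertW (2 * Real.log n) →
        ∀ (Ω : Type*) [MeasurableSpace Ω] (P : Measure Ω) [IsProbabilityMeasure P]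
          (X : Fin n → Ω → Fin d → ℝ),
          iIndepFun X P →
          (∀ i, pdf.IsUniform (X i) (Set.Icc 0 1) P volume) →
          ∃ ε : ℝ,
            |ε| ≤ C * ((d : ℝ) * (n : ℝ) ^ (-(1 / (((d : ℝ) - 1) * ((d : ℝ) - 2))))) ∧
            ∫ ω, (kSkylineCount (d - 1) (fun i => X i ω) : ℝ) ∂P =
              (n : ℝ) ^ (-(1 / ((d : ℝ) - 1))) / ((d : ℝ) - 1) *
                Real.Gamma (1 / ((d : ℝ) - 1)) ^ d * (1 + ε) := by
  refine ⟨4488, fun K hK => ?_⟩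
  filter_upwards [hK.eventually_ge_atTop 1, eventually_ge_atTop 2] with n hKn hn2 d hd hcond
    Ω _ P _ X hX hU
  obtain ⟨m, rfl⟩ : ∃ m, n = m + 1 := ⟨n - 1, by omega⟩
  obtain ⟨e, rfl⟩ : ∃ e, d = e + 1 := ⟨d - 1, by omega⟩
  have he : 2 ≤ e := by omega
  have hn1 : (1 : ℝ) < (m + 1 : ℕ) := by exact_mod_cast hn2
  have hn0 : (0 : ℝ) < (m + 1 : ℕ) := by linarith
  -- Only `K n ≥ 1` and positivity of `lambertW` are needed; `n ≥ 2` ensures `log n > 0`.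
  have hlog : (((e + 1 : ℕ) : ℝ)) ^ 2 ≤ 2 * Real.log (m + 1 : ℕ) := by
    have hW := lambertW_pos (show 0 < 2 * Real.log (m + 1 : ℕ) by
      have := Real.log_pos hn1; linarith)
    have h1 : 1 ≤ 2 * Real.log (m + 1 : ℕ) / ((e + 1 : ℕ) : ℝ) ^ 2 := by linarith
    rwa [one_le_div (by positivity)] at h1
  have hmain := abs_lintegral_toReal_sub_leaveOneOutLaplace_le he hlog
  rw [integral_kSkylineCount P X hX hU, Nat.add_sub_cancel]
  set I := (∫⁻ x in Set.Icc (0 : Fin (e + 1) → ℝ) 1,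
    ENNReal.ofReal ((1 - dominationProb e x) ^ m)).toReal with hI
  set A := leaveOneOutLaplace (e + 1) (m + 1 : ℕ) with hA
  have hA0 : 0 < A := leaveOneOutLaplace_pos (by omega) hn0
  have hde : ((e + 1 : ℕ) : ℝ) - 1 = e := by push_cast; ring
  have he0 : (0 : ℝ) < e := by exact_mod_cast (by omega : 0 < e)
  refine ⟨I / A - 1, ?_, ?_⟩
  · rw [show ((e + 1 : ℕ) : ℝ) - 2 = e - 1 by push_cast; ring, hde,
      show I / A - 1 = (I - A) / A by field_simp, abs_div, abs_of_pos hA0, div_le_iff₀ hA0]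
    exact hmain
  -- The prefactor `n` lowers the exponent of `1 / n` from `d / (d - 1)` to `1 / (d - 1)`.
  · have hnA : ((m + 1 : ℕ) : ℝ) ^ (-(1 / (((e + 1 : ℕ) : ℝ) - 1))) / (((e + 1 : ℕ) : ℝ) - 1) *
        Real.Gamma (1 / (((e + 1 : ℕ) : ℝ) - 1)) ^ (e + 1) = ((m + 1 : ℕ) : ℝ) * A := by
      have h1 : ((m + 1 : ℕ) : ℝ) ^ (-(1 / (e : ℝ))) =
          ((m + 1 : ℕ) : ℝ) * (1 / ((m + 1 : ℕ) : ℝ)) ^ (((e + 1 : ℕ) : ℝ) / (e : ℝ)) := by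
        rw [one_div ((m + 1 : ℕ) : ℝ), Real.inv_rpow hn0.le, ← Real.rpow_neg hn0.le,
          ← Real.rpow_one_add' hn0.le]
        · congr 1
          push_cast
          field_simp
          ring
        · push_cast
          field_simp
          norm_num
          omega
      rw [hA, leaveOneOutLaplace, hde, h1]
      ring
    rw [hnA]
    field_simp
    ring
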